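/- Call a set $X\subseteq 2^\omega$ a $Q_B$-set if for every $Y\subseteq X$ there is a Borel set $B\subseteq 2^\omega$ with $B\cap X=Y$. Let $\mathcal P(\mathbb R)/\mathrm{Ctble}$ be the quotient of the Boolean algebra of all subsets of $\mathbb R$ by the ideal of countable sets, and write $[A]$ for the class of $A\subseteq\mathbb R$. Suppose that there is a $Q_B$-set of cardinality $\omega_1$, and that the union of any two $Q_B$-sets of cardinality $\omega_1$ is a $Q_B$-set. Then every automorphism $\pi$ of the Boolean algebra $\mathcal P(\mathbb R)/\mathrm{Ctble}$ is trivial, that is, there is a function $f:\mathbb R\to\mathbb R$ such that $\pi([A])=[f^{-1}(A)]$ for all $A\subseteq\mathbb R$. -/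

import Mathlib

open scoped symmDiff Cardinal

/-- Two subsets of `X` are equivalent modulo the ideal `I` if their symmetric difference
belongs to `I`. -/
def modSetoid {X : Type*} (I : Order.Ideal (Set X)) : Setoid (Set X) where
  r A B := A ∆ B ∈ I
  iseqv :=
    { refl := fun A => by
        have h : A ∆ A = ⊥ := symmDiff_self A
        rw [h]
        exact I.bot_mem
      symm := fun {A B} h => by
        rwa [symmDiff_comm]
      trans := fun {A B C} h₁ h₂ => I.lower (symmDiff_triangle A B C) (I.sup_mem h₁ h₂) }

/-- The quotient `P(X)/I` of the power set of `X` by an ideal `I` of subsets of `X`. -/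
def PowMod {X : Type*} (I : Order.Ideal (Set X)) : Type _ := Quotient (modSetoid I)

namespace PowMod

/-- The class `[A]` of `A ⊆ X` in `P(X)/I`. -/
def mk {X : Type*} (I : Order.Ideal (Set X)) (A : Set X) : PowMod I :=
  Quotient.mk (modSetoid I) A

theorem mk_eq_mk {X : Type*} {I : Order.Ideal (Set X)} {A B : Set X} :
    mk I A = mk I B ↔ A ∆ B ∈ I :=
  ⟨fun h => Quotient.exact h, fun h => Quotient.sound (s := modSetoid I) h⟩

theorem sdiff_congr {X : Type*} {I : Order.Ideal (Set X)} {A A' B B' : Set X}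
    (hA : A ∆ A' ∈ I) (hB : B ∆ B' ∈ I) (h : A \ B ∈ I) : A' \ B' ∈ I := by
  refine I.lower (?_ : A' \ B' ≤ (A \ B) ⊔ (A ∆ A' ⊔ B ∆ B')) (I.sup_mem h (I.sup_mem hA hB))
  intro x hx
  simp only [Set.sup_eq_union, Set.mem_union, Set.mem_symmDiff, Set.mem_sdiff] at hx ⊢
  tauto

/-- The Boolean algebra structure of `P(X)/I`: the order is `[A] ≤ [B]` iff `A \ B ∈ I`, and the
operations are induced by union, intersection and complement of representatives. -/
instance {X : Type*} (I : Order.Ideal (Set X)) : BooleanAlgebra (PowMod I) where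
  le := Quotient.lift₂ (fun A B => A \ B ∈ I) fun A B A' B' hA hB =>
    propext ⟨sdiff_congr hA hB, sdiff_congr ((modSetoid I).symm hA) ((modSetoid I).symm hB)⟩
  le_refl := by
    rintro ⟨A⟩
    change A \ A ∈ I
    rw [Set.sdiff_self]
    exact I.bot_mem
  le_trans := by
    rintro ⟨A⟩ ⟨B⟩ ⟨C⟩ h₁ h₂
    exact I.lower (sdiff_triangle A B C) (I.sup_mem h₁ h₂)
  le_antisymm := by
    rintro ⟨A⟩ ⟨B⟩ h₁ h₂
    exact Quotient.sound (s := modSetoid I) (I.sup_mem h₁ h₂)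
  sup := Quotient.map₂ (fun A B => A ∪ B) fun A A' hA B B' hB => by
    refine I.lower (?_ : (A ∪ B) ∆ (A' ∪ B') ≤ A ∆ A' ⊔ B ∆ B') (I.sup_mem hA hB)
    intro x hx
    simp only [Set.sup_eq_union, Set.mem_union, Set.mem_symmDiff] at hx ⊢
    tauto
  inf := Quotient.map₂ (fun A B => A ∩ B) fun A A' hA B B' hB => by
    refine I.lower (?_ : (A ∩ B) ∆ (A' ∩ B') ≤ A ∆ A' ⊔ B ∆ B') (I.sup_mem hA hB)
    intro x hx
    simp only [Set.sup_eq_union, Set.mem_union, Set.mem_inter_iff, Set.mem_symmDiff] at hx ⊢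
    tauto
  compl := Quotient.map (fun A => Aᶜ) fun A A' hA => by
    change Aᶜ ∆ A'ᶜ ∈ I
    rw [compl_symmDiff_compl]
    exact hA
  top := mk I Set.univ
  bot := mk I ∅
  le_sup_left := by
    rintro ⟨A⟩ ⟨B⟩
    change A \ (A ∪ B) ∈ I
    rw [Set.sdiff_eq_empty.2 Set.subset_union_left]
    exact I.bot_mem
  le_sup_right := by
    rintro ⟨A⟩ ⟨B⟩
    change B \ (A ∪ B) ∈ I
    rw [Set.sdiff_eq_empty.2 Set.subset_union_right]
    exact I.bot_mem
  sup_le := by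
    rintro ⟨A⟩ ⟨B⟩ ⟨C⟩ h₁ h₂
    change (A ∪ B) \ C ∈ I
    rw [Set.union_sdiff_distrib]
    exact I.sup_mem h₁ h₂
  inf_le_left := by
    rintro ⟨A⟩ ⟨B⟩
    change (A ∩ B) \ A ∈ I
    rw [Set.sdiff_eq_empty.2 Set.inter_subset_left]
    exact I.bot_mem
  inf_le_right := by
    rintro ⟨A⟩ ⟨B⟩
    change (A ∩ B) \ B ∈ I
    rw [Set.sdiff_eq_empty.2 Set.inter_subset_right]
    exact I.bot_mem
  le_inf := by
    rintro ⟨A⟩ ⟨B⟩ ⟨C⟩ h₁ h₂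
    change A \ (B ∩ C) ∈ I
    rw [Set.sdiff_inter]
    exact I.sup_mem h₁ h₂
  le_sup_inf := by
    rintro ⟨A⟩ ⟨B⟩ ⟨C⟩
    change ((A ∪ B) ∩ (A ∪ C)) \ (A ∪ B ∩ C) ∈ I
    rw [Set.union_inter_distrib_left, Set.sdiff_self]
    exact I.bot_mem
  inf_compl_le_bot := by
    rintro ⟨A⟩
    change (A ∩ Aᶜ) \ ∅ ∈ I
    rw [Set.inter_compl_self, Set.sdiff_self]
    exact I.bot_mem
  top_le_sup_compl := by
    rintro ⟨A⟩
    change Set.univ \ (A ∪ Aᶜ) ∈ I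
    rw [Set.union_compl_self, Set.sdiff_self]
    exact I.bot_mem
  le_top := by
    rintro ⟨A⟩
    change A \ Set.univ ∈ I
    rw [Set.sdiff_univ]
    exact I.bot_mem
  bot_le := by
    rintro ⟨A⟩
    change ∅ \ A ∈ I
    rw [Set.empty_sdiff]
    exact I.bot_mem

theorem mk_le_mk {X : Type*} {I : Order.Ideal (Set X)} {A B : Set X} :
    mk I A ≤ mk I B ↔ A \ B ∈ I :=
  Iff.rfl

/-- A map `π : P(X)/I → P(Y)/J` is trivial if there is a function `f : Y → X` with
`π [A] = [f⁻¹(A)]` for all `A ⊆ X`. -/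
def IsTrivial {X Y : Type*} {I : Order.Ideal (Set X)} {J : Order.Ideal (Set Y)}
    (π : PowMod I → PowMod J) : Prop :=
  ∃ f : Y → X, ∀ A : Set X, π (mk I A) = mk J (f ⁻¹' A)

end PowMod

/-- The ideal `Ctble` of countable subsets of `X`. -/
def Ctble (X : Type*) : Order.Ideal (Set X) where
  carrier := {A | A.Countable}
  lower' := fun _ _ hBA hA => Set.Countable.mono hBA hA
  nonempty' := ⟨∅, Set.countable_empty⟩
  directed' := fun A hA B hB =>
    ⟨A ∪ B, Set.Countable.union hA hB, Set.subset_union_left, Set.subset_union_right⟩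

/-- A subset `X` of the Cantor space `2^ω` is a `Q_B`-set if every subset of `X` is the
intersection of `X` with a Borel subset of `2^ω`. The space `ℕ → Bool` carries the product of the
discrete topologies. -/
def IsQBSet (X : Set (ℕ → Bool)) : Prop :=
  ∀ Y ⊆ X, ∃ B : Set (ℕ → Bool), @MeasurableSet (ℕ → Bool) (borel (ℕ → Bool)) B ∧ B ∩ X = Y

/-!
The automorphism `π` is already trivial on Borel sets, for any way of mapping `ℝ` into the Cantor
space `2^ω`: if `e : ℝ → 2^ω` is any function and the coordinates of `f : ℝ → 2^ω` are read off from
representatives of `π [e⁻¹ N]`, with `N` ranging over the countably many subbasic clopen sets, then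
`π [e⁻¹ B] = [f⁻¹ B]` for every Borel set `B`, because countable unions are suprema in
`P(ℝ)/Ctble` and `π` preserves suprema (`PowMod.exists_preimage_borel`).

Let `A ⊆ ℝ` have cardinality at most `ω₁`, let `e` map `A` injectively into a `Q_B`-set `X` of
cardinality `ω₁`, and let `[S] = π [A]`. All subsets of `A` are traces of sets `e⁻¹ B` with `B` Borel,
so `π` carries them to the traces on `S` of the sets `f⁻¹ B`. Consequently `f '' S` is itself a
`Q_B`-set. If `f '' S \ X` were uncountable, it would contain a set of cardinality `ω₁` whose union
with `X` is a `Q_B`-set, and a Borel set separating it from `X` would contradict `π [A] = [S]`.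
Since the fibres of `f` on `S` are countable, `f` maps all but countably many points of `S` into
`X`, and `π` is trivial on subsets of `A`
(`PowMod.exists_preimage_of_card_le`).

The maps obtained for different `A` all agree, up to countable sets, with the single map obtained
from an injection `ℝ → 2^ω`, since they have to agree on the subbasic clopen sets. This single map
works for every set of cardinality at most `ω₁`, and then for every set: a discrepancy would be an
uncountable set, it would contain one of cardinality `ω₁`, and `π⁻¹` does not increase cardinality
beyond `ω₁`.
-/

theorem IsQBSet.mono {X Y : Set (ℕ → Bool)} (hX : IsQBSet X) (h : Y ⊆ X) : IsQBSet Y := by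
  intro T hT
  obtain ⟨B, hB, hBX⟩ := hX T (hT.trans h)
  refine ⟨B, hB, Set.Subset.antisymm (fun x hx => ?_) (fun x hx => ⟨?_, hT hx⟩)⟩
  · exact hBX ▸ ⟨hx.1, h hx.2⟩
  · exact (hBX.symm ▸ hx : x ∈ B ∩ X).1

theorem borel_eq_pi_bool : borel (ℕ → Bool) = MeasurableSpace.pi :=
  (BorelSpace.measurable_eq (α := ℕ → Bool)).symm

/-- It suffices to realise the subsets of `X` as traces of Borel sets up to countable errors. -/
theorem IsQBSet.of_countable_symmDiff {X : Set (ℕ → Bool)}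
    (h : ∀ Y ⊆ X, ∃ B : Set (ℕ → Bool), MeasurableSet B ∧ ((B ∩ X) ∆ Y).Countable) :
    IsQBSet X := by
  intro Y hY
  obtain ⟨B, hB, hN⟩ := h Y hY
  refine ⟨(B \ ((B ∩ X) ∆ Y)) ∪ (Y \ B), ?_, ?_⟩
  · rw [borel_eq_pi_bool]
    refine (hB.diff hN.measurableSet).union (Set.Countable.measurableSet (hN.mono ?_))
    intro x hx
    simp only [Set.mem_symmDiff, Set.mem_inter_iff, Set.mem_sdiff] at hx ⊢
    tauto
  · ext x
    have := @hY x
    simp only [Set.mem_symmDiff, Set.mem_inter_iff, Set.mem_sdiff, Set.mem_union]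
    tauto

namespace PowMod

theorem exists_mk_eq {X : Type*} {I : Order.Ideal (Set X)} (a : PowMod I) :
    ∃ A : Set X, mk I A = a :=
  Quotient.exists_rep a

theorem mk_inter {X : Type*} {I : Order.Ideal (Set X)} (A B : Set X) :
    mk I (A ∩ B) = mk I A ⊓ mk I B := rfl

theorem mk_union {X : Type*} {I : Order.Ideal (Set X)} (A B : Set X) :
    mk I (A ∪ B) = mk I A ⊔ mk I B := rfl

theorem mk_compl {X : Type*} {I : Order.Ideal (Set X)} (A : Set X) :
    mk I Aᶜ = (mk I A)ᶜ := rfl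

theorem mk_mono {X : Type*} {I : Order.Ideal (Set X)} {A B : Set X} (h : A ⊆ B) :
    mk I A ≤ mk I B := by
  rw [mk_le_mk, Set.sdiff_eq_empty.2 h]
  exact I.bot_mem

section Ctble

variable {α β : Type}

theorem mk_ctble_le {A B : Set α} : mk (Ctble α) A ≤ mk (Ctble α) B ↔ (A \ B).Countable :=
  Iff.rfl

theorem mk_ctble_eq_bot {A : Set α} : mk (Ctble α) A = ⊥ ↔ A.Countable := by
  rw [← le_bot_iff]
  change (A \ ∅).Countable ↔ _
  rw [Set.sdiff_empty]

theorem isLUB_mk_iUnion (A : ℕ → Set α) :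
    IsLUB (Set.range fun n => mk (Ctble α) (A n)) (mk (Ctble α) (⋃ n, A n)) := by
  constructor
  · rintro _ ⟨n, rfl⟩
    exact mk_mono (Set.subset_iUnion A n)
  · intro c hc
    obtain ⟨C, rfl⟩ := exists_mk_eq c
    rw [mk_ctble_le, Set.iUnion_sdiff]
    exact Set.countable_iUnion fun n => mk_ctble_le.1 (hc ⟨n, rfl⟩)

/-- An isomorphism is induced by a point map as far as preimages of Borel sets under a fixed
map `e` into the Cantor space are concerned. -/
theorem exists_preimage_borel (π : PowMod (Ctble α) ≃o PowMod (Ctble β)) (e : α → ℕ → Bool) :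
    ∃ f : β → ℕ → Bool, ∀ B : Set (ℕ → Bool), MeasurableSet B →
      π (mk _ (e ⁻¹' B)) = mk _ (f ⁻¹' B) := by
  classical
  choose P hP using fun n => exists_mk_eq (π (mk _ {x | e x n = true}))
  let f : β → ℕ → Bool := fun y n => decide (y ∈ P n)
  -- The sets on which `f` induces `π` form a σ-algebra.
  let M : MeasurableSpace (ℕ → Bool) :=
    { MeasurableSet' := fun B => π (mk _ (e ⁻¹' B)) = mk _ (f ⁻¹' B)
      measurableSet_empty := π.map_bot
      measurableSet_compl := fun B hB => by
        rw [Set.preimage_compl, Set.preimage_compl, mk_compl, mk_compl, map_compl, hB]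
      measurableSet_iUnion := fun B hB => by
        rw [Set.preimage_iUnion, Set.preimage_iUnion]
        refine IsLUB.unique ?_ (isLUB_mk_iUnion _)
        have h := (π.isLUB_image' (s := _) (x := _)).2 (isLUB_mk_iUnion fun n => e ⁻¹' B n)
        rw [← Set.range_comp] at h
        convert h using 2
        funext n
        exact (hB n).symm }
  have htrue : ∀ n, @MeasurableSet _ M ((fun x : ℕ → Bool => x n) ⁻¹' {true}) := by
    intro n
    change π (mk _ {x | e x n = true}) = mk _ {y | decide (y ∈ P n) = true}
    simp only [decide_eq_true_eq, Set.ofPred_mem_eq, hP]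
  have hle : MeasurableSpace.pi ≤ M := by
    refine iSup_le fun n => ?_
    rw [← measurable_iff_comap_le]
    exact @measurable_to_bool _ M _ (htrue n)
  exact ⟨f, fun B hB => hle B hB⟩

/-- Under the hypotheses on `Q_B`-sets, an isomorphism of the algebras modulo countable sets is
bounded above by a point map on the subsets of any set `A` of cardinality at most `ω₁` (comparing
complements in `A` turns this bound into an equality below `π [A]`), and it sends `A` to the class
of a set of cardinality at most `ω₁`. -/
theorem exists_preimage_of_card_le [Nonempty α]
    (hex : ∃ X : Set (ℕ → Bool), IsQBSet X ∧ #X = ℵ₁)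
    (hunion : ∀ X Y : Set (ℕ → Bool), IsQBSet X → #X = ℵ₁ → IsQBSet Y → #Y = ℵ₁ →
      IsQBSet (X ∪ Y))
    (π : PowMod (Ctble α) ≃o PowMod (Ctble β)) {A : Set α} (hA : #A ≤ ℵ₁) :
    (∃ g : β → α, ∀ Y ⊆ A, π (mk _ Y) ≤ mk _ (g ⁻¹' Y)) ∧
      ∃ S : Set β, mk _ S = π (mk _ A) ∧ #S ≤ ℵ₁ := by
  classical
  obtain ⟨X, hX, hXcard⟩ := hex
  obtain ⟨e, hinj, hmaps⟩ : ∃ e : α → ℕ → Bool, Set.InjOn e A ∧ Set.MapsTo e A X := by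
    obtain ⟨i⟩ : #A ≤ #X := hXcard ▸ hA
    refine ⟨fun a => if h : a ∈ A then i ⟨a, h⟩ else default, ?_, ?_⟩
    · intro a ha b hb hab
      simp only [ha, hb, dif_pos] at hab
      simpa using i.injective (Subtype.ext hab)
    · intro a ha
      simp only [ha, dif_pos]
      exact (i ⟨a, ha⟩).2
  obtain ⟨f, hf⟩ := exists_preimage_borel π e
  obtain ⟨S, hS⟩ := exists_mk_eq (π (mk _ A))
  have htrace : ∀ B : Set (ℕ → Bool), MeasurableSet B →
      π (mk _ (A ∩ e ⁻¹' B)) = mk _ (S ∩ f ⁻¹' B) := by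
    intro B hB
    rw [mk_inter, mk_inter, map_inf, hf B hB, hS]
  have hborel : ∀ Y ⊆ A, ∃ B : Set (ℕ → Bool), MeasurableSet B ∧ B ∩ X = e '' Y ∧
      π (mk _ Y) = mk _ (S ∩ f ⁻¹' B) := by
    intro Y hY
    obtain ⟨B, hB, hBX⟩ := hX (e '' Y) ((Set.image_mono hY).trans hmaps.image_subset)
    rw [borel_eq_pi_bool] at hB
    refine ⟨B, hB, hBX, ?_⟩
    rw [← htrace B hB]
    congr 2
    ext a
    constructor
    · intro ha
      exact ⟨hY ha, (hBX.symm ▸ Set.mem_image_of_mem e ha : e a ∈ B ∩ X).1⟩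
    · rintro ⟨ha, hab⟩
      exact (hinj.mem_image_iff hY ha).1 (hBX ▸ ⟨hab, hmaps ha⟩)
  -- `f ⁻¹' {z}` corresponds to `e ⁻¹' {z}`, which has at most one point in `A`.
  have hfiber : ∀ z, (S ∩ f ⁻¹' {z}).Countable := by
    intro z
    rw [← mk_ctble_eq_bot, ← htrace _ (measurableSet_singleton z), map_eq_bot_iff, mk_ctble_eq_bot]
    exact Set.Subsingleton.countable fun a ha b hb => hinj ha.1 hb.1 (ha.2.trans hb.2.symm)
  have hpre : ∀ T : Set (ℕ → Bool), T.Countable → (S ∩ f ⁻¹' T).Countable := by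
    intro T hT
    rw [← Set.biUnion_of_singleton T, Set.preimage_iUnion₂, Set.inter_iUnion₂]
    exact hT.biUnion fun z _ => hfiber z
  have hZ : IsQBSet (f '' S) := by
    refine IsQBSet.of_countable_symmDiff fun T hT => ?_
    obtain ⟨Y₀, hY₀⟩ := exists_mk_eq (π.symm (mk _ (S ∩ f ⁻¹' T)))
    obtain ⟨B, hB, -, hBY⟩ := hborel (Y₀ ∩ A) Set.inter_subset_right
    refine ⟨B, hB, ?_⟩
    rw [mk_inter, map_inf, hY₀, OrderIso.apply_symm_apply, ← hS, ← mk_inter, mk_eq_mk] at hBY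
    refine (Set.Countable.image hBY f).mono ?_
    rintro z (⟨⟨hzB, y, hy, rfl⟩, hzT⟩ | ⟨hzT, hz⟩)
    · exact ⟨y, Or.inr ⟨⟨hy, hzB⟩, fun h => hzT h.1.2⟩, rfl⟩
    · obtain ⟨y, hy, rfl⟩ := hT hzT
      exact ⟨y, Or.inl ⟨⟨⟨hy, hzT⟩, hy⟩, fun h => hz ⟨h.2, y, hy, rfl⟩⟩, rfl⟩
  have hZX : (f '' S \ X).Countable := by
    by_contra hunc
    have hle : ℵ₁ ≤ #(f '' S \ X : Set (ℕ → Bool)) := by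
      rw [← Cardinal.le_aleph0_iff_set_countable, not_le] at hunc
      rw [← Cardinal.succ_aleph0]
      exact Order.succ_le_of_lt hunc
    obtain ⟨Z, hZsub, hZcard⟩ := Cardinal.le_mk_iff_exists_subset.1 hle
    obtain ⟨B, hB, hBX⟩ := hunion X Z hX hXcard (hZ.mono (hZsub.trans Set.sdiff_subset)) hZcard
      X Set.subset_union_left
    rw [borel_eq_pi_bool] at hB
    have hXB : X ⊆ B := fun x hx => (hBX.symm ▸ hx : x ∈ B ∩ (X ∪ Z)).1
    have hSB : (S \ f ⁻¹' B).Countable := by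
      rw [← mk_ctble_le, hS, ← hf B hB, π.le_iff_le]
      exact mk_mono fun a ha => hXB (hmaps ha)
    have hZc : Z.Countable := by
      refine (hSB.image f).mono fun z hz => ?_
      obtain ⟨⟨y, hy, rfl⟩, hzX⟩ := hZsub hz
      exact ⟨y, ⟨hy, fun hyB => hzX (hBX.subset ⟨hyB, Or.inr hz⟩)⟩, rfl⟩
    rw [← Cardinal.le_aleph0_iff_set_countable, hZcard] at hZc
    exact hZc.not_gt Cardinal.aleph0_lt_aleph_one
  have hSX : (S \ f ⁻¹' X).Countable := by
    refine (hpre _ hZX).mono ?_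
    rintro y ⟨hy, hyX⟩
    exact ⟨hy, ⟨y, hy, rfl⟩, hyX⟩
  have hsub : ∀ Y ⊆ A, π (mk _ Y) ≤ mk _ (f ⁻¹' (e '' Y)) := by
    intro Y hY
    obtain ⟨B, -, hBX, hBY⟩ := hborel Y hY
    rw [hBY, mk_ctble_le, ← hBX]
    refine hSX.mono ?_
    rintro y ⟨⟨hy, hyB⟩, hyBX⟩
    exact ⟨hy, fun h => hyBX ⟨hyB, h⟩⟩
  refine ⟨⟨fun y => Function.invFunOn e A (f y), fun Y hY => (hsub Y hY).trans (mk_mono ?_)⟩,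
    S ∩ f ⁻¹' (e '' A), ?_, ?_⟩
  · rintro y ⟨a, ha, hay⟩
    change Function.invFunOn e A (f y) ∈ Y
    rwa [← hay, hinj.leftInvOn_invFunOn (hY ha)]
  · rw [mk_inter, hS]
    exact inf_eq_left.2 (hsub A subset_rfl)
  · have hfibers : S ∩ f ⁻¹' (e '' A) = ⋃ a : A, S ∩ f ⁻¹' {e a} := by
      ext y
      simp only [Set.mem_inter_iff, Set.mem_preimage, Set.mem_image, Set.mem_iUnion,
        Set.mem_singleton_iff, Subtype.exists, exists_and_left, exists_prop, eq_comm]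
    rw [hfibers]
    refine (Cardinal.mk_iUnion_le _).trans ?_
    refine (mul_le_mul' hA (ciSup_le' (a := ℵ₀) fun a => (hfiber _).le_aleph0)).trans ?_
    exact (Cardinal.mul_eq_left Cardinal.aleph0_lt_aleph_one.le
      Cardinal.aleph0_lt_aleph_one.le Cardinal.aleph0_ne_zero).le

/-- Under the hypotheses on `Q_B`-sets, isomorphisms of the algebras modulo countable sets are
trivial when the points of the domain are separated by countably many sets. -/
theorem isTrivial_of_injective [Nonempty α] [Nonempty β]
    (hex : ∃ X : Set (ℕ → Bool), IsQBSet X ∧ #X = ℵ₁)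
    (hunion : ∀ X Y : Set (ℕ → Bool), IsQBSet X → #X = ℵ₁ → IsQBSet Y → #Y = ℵ₁ →
      IsQBSet (X ∪ Y))
    {e : α → ℕ → Bool} (he : Function.Injective e)
    (π : PowMod (Ctble α) ≃o PowMod (Ctble β)) : IsTrivial π := by
  obtain ⟨f, hf⟩ := exists_preimage_borel π e
  have hsmall : ∀ A : Set α, #A ≤ ℵ₁ →
      π (mk _ A) ≤ mk _ ((fun y => Function.invFun e (f y)) ⁻¹' A) := by
    intro A hA
    obtain ⟨⟨g, hg⟩, -⟩ := exists_preimage_of_card_le hex hunion π hA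
    obtain ⟨S, hS⟩ := exists_mk_eq (π (mk _ A))
    -- `e ∘ g` and `f` agree in each coordinate off a countable set, as both induce `π` on the
    -- subsets of `A` cut out by that coordinate.
    have hcoord : ∀ n, (S \ {y | e (g y) n = f y n}).Countable := by
      intro n
      have hval : ∀ b : Bool,
          π (mk _ (A ∩ e ⁻¹' {x | x n = b})) ≤ mk _ {y | e (g y) n = f y n} := by
        intro b
        have hb : MeasurableSet {x : ℕ → Bool | x n = b} :=
          measurable_pi_apply (X := fun _ : ℕ => Bool) n (measurableSet_singleton b)
        refine (le_inf (hg _ Set.inter_subset_left)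
          ((π.monotone (mk_mono Set.inter_subset_right)).trans (hf _ hb).le)).trans ?_
        rw [← mk_inter]
        exact mk_mono fun y hy => hy.1.2.trans hy.2.symm
      rw [← mk_ctble_le, hS]
      have hsplit : A = (A ∩ e ⁻¹' {x | x n = true}) ∪ (A ∩ e ⁻¹' {x | x n = false}) := by
        ext a
        cases h : e a n <;> simp [h]
      rw [hsplit, mk_union, map_sup]
      exact sup_le (hval true) (hval false)
    have hSg : (S \ g ⁻¹' A).Countable := by
      rw [← mk_ctble_le, hS]
      exact hg A subset_rfl
    rw [← hS, mk_ctble_le]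
    refine (hSg.union (Set.countable_iUnion hcoord)).mono fun y hy => ?_
    by_contra hcon
    simp only [Set.mem_union, Set.mem_iUnion, Set.mem_sdiff, Set.mem_preimage, Set.mem_ofPred_eq,
      not_or, not_exists, not_and, not_not] at hcon
    have hey : e (g y) = f y := funext fun n => hcon.2 n hy.1
    refine hy.2 ?_
    change Function.invFun e (f y) ∈ A
    rw [← hey, Function.leftInverse_invFun he]
    exact hcon.1 hy.1
  have hall : ∀ A : Set α, π (mk _ A) ≤ mk _ ((fun y => Function.invFun e (f y)) ⁻¹' A) := by
    intro A
    obtain ⟨S, hS⟩ := exists_mk_eq (π (mk _ A))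
    rw [← hS, mk_ctble_le]
    by_contra hunc
    have hle : ℵ₁ ≤ #(S \ (fun y => Function.invFun e (f y)) ⁻¹' A : Set β) := by
      rw [← Cardinal.le_aleph0_iff_set_countable, not_le] at hunc
      rw [← Cardinal.succ_aleph0]
      exact Order.succ_le_of_lt hunc
    obtain ⟨W, hWsub, hWcard⟩ := Cardinal.le_mk_iff_exists_subset.1 hle
    obtain ⟨-, A₀, hA₀, hA₀card⟩ := exists_preimage_of_card_le hex hunion π.symm hWcard.le
    have hA' : π (mk _ (A₀ ∩ A)) = mk _ W := by
      rw [mk_inter, map_inf, hA₀, OrderIso.apply_symm_apply, ← hS]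
      exact inf_eq_left.2 (mk_mono (hWsub.trans Set.sdiff_subset))
    have hW := hsmall (A₀ ∩ A) ((Cardinal.mk_le_mk_of_subset Set.inter_subset_left).trans hA₀card)
    rw [hA', mk_ctble_le] at hW
    have hWc : W.Countable := by
      refine hW.mono ?_
      intro y hy
      exact ⟨hy, fun h => (hWsub hy).2 h.2⟩
    rw [← Cardinal.le_aleph0_iff_set_countable, hWcard] at hWc
    exact hWc.not_gt Cardinal.aleph0_lt_aleph_one
  refine ⟨fun y => Function.invFun e (f y), fun A => (hall A).antisymm ?_⟩
  -- The reverse inequality is the one just proved, for the complement of `A`.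
  have h := hall Aᶜ
  rw [mk_compl, map_compl, Set.preimage_compl, mk_compl] at h
  exact compl_le_compl_iff_le.1 h

end Ctble

end PowMod

/-- If there is a `Q_B`-set of cardinality `ω₁` and the union of any two `Q_B`-sets of cardinality
`ω₁` is a `Q_B`-set, then every automorphism of the Boolean algebra `P(ℝ)/Ctble` is trivial
(an isomorphism of Boolean algebras is the same as an isomorphism of the underlying orders). -/
theorem corollary5p4
    (hex : ∃ X : Set (ℕ → Bool), IsQBSet X ∧ #X = ℵ₁)
    (hunion : ∀ X Y : Set (ℕ → Bool), IsQBSet X → #X = ℵ₁ → IsQBSet Y → #Y = ℵ₁ →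
      IsQBSet (X ∪ Y))
    (π : PowMod (Ctble ℝ) ≃o PowMod (Ctble ℝ)) :
    PowMod.IsTrivial π := by
  obtain ⟨i⟩ : #ℝ ≤ #(ℕ → Bool) := by
    simp [Cardinal.mk_real]
  exact PowMod.isTrivial_of_injective hex hunion i.injective π
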